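/- For a function $\phi:\mathbb{R}\to\mathbb{R}$ and $m\ge 1$, let $\mathcal{S}_m(\phi)$ be the set of all functions $F:\mathbb{R}^m\to\mathbb{R}$ of the form $F(x)=\sum_{i=1}^{k}t_i\,\phi(\langle y_i,x\rangle+\varrho_i)$ with $k\in\mathbb{N}$, $y_i\in\mathbb{R}^m$ and $t_i,\varrho_i\in\mathbb{R}$ (the functions expressed by shallow $\phi$-networks). Let $n\ge 0$ be an integer, let $2\le p<\infty$, and let $\Omega=\mathbb{R}\times[0,1]^n\subset\mathbb{R}^{n+1}$ with Lebesgue measure. Let $\phi$ be one of the functions $$\mathrm{ReLU}(x)=\begin{cases}x,&x>0,\\0,&x\le 0,\end{cases}\qquad \mathrm{ELU}(x)=\begin{cases}x,&x>0,\\ \alpha(e^x-1),&x\le 0,\end{cases}$$ $$\mathrm{Softplus}(x)=\log(e^x+1),\qquad \mathrm{LeakyReLU}(x)=\begin{cases}x,&x>0,\\ \alpha x,&x\le 0,\end{cases}$$ where $\alpha$ is any real number in the case of ELU, and any real number with $\alpha\ne 1$ in the case of LeakyReLU. Then $$\overline{\mathcal{S}_{n+1}(\phi)\cap L^p(\Omega)}=L^p(\Omega),$$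 where $L^p(\Omega)$ is the space of real-valued $L^p$ functions on $\Omega$, functions on $\mathbb{R}^{n+1}$ are restricted to $\Omega$, and the closure is taken in the $L^p$ norm. -/

import Mathlib

namespace ShallowNet

noncomputable section

/-- The rectified linear unit. -/
def reLU (x : ℝ) : ℝ := if 0 < x then x else 0

/-- The exponential linear unit with parameter `α`. -/
def elu (α x : ℝ) : ℝ := if 0 < x then x else α * (Real.exp x - 1)

/-- The softplus function. -/
def softplus (x : ℝ) : ℝ := Real.log (Real.exp x + 1)

/-- The leaky rectified linear unit with parameter `α`. The requirement `α ≠ 1` is imposed where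
the function is used. -/
def leakyReLU (α x : ℝ) : ℝ := if 0 < x then x else α * x

/-- The set of all functions on `ℝᵐ` expressed by a shallow network with activation function `φ`,
that is, of all finite sums `x ↦ ∑ i, tᵢ φ(⟨yᵢ, x⟩ + ϱᵢ)`. -/
def networks (m : ℕ) (φ : ℝ → ℝ) : Set (EuclideanSpace ℝ (Fin m) → ℝ) :=
  {F | ∃ (k : ℕ) (y : Fin k → EuclideanSpace ℝ (Fin m)) (ϱ t : Fin k → ℝ),
    F = fun x => ∑ i, t i * φ (inner ℝ (y i) x + ϱ i)}

/-- The domain `ℝ × [0, 1]ⁿ`, as a subset of `ℝⁿ⁺¹`: the coordinate with index `0` is free, the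
remaining `n` coordinates lie in the unit interval. -/
def strip (n : ℕ) : Set (EuclideanSpace ℝ (Fin (n + 1))) :=
  {x | ∀ i : Fin n, x i.succ ∈ Set.Icc (0 : ℝ) 1}

/-- The set `S ∩ Lᵖ(Ω)`: the classes in the real space `Lᵖ(Ω)` (with Lebesgue measure) that are
represented by the restriction to `Ω` of a function in `S`. -/
def interLp {m : ℕ} (S : Set (EuclideanSpace ℝ (Fin m) → ℝ)) (p : ENNReal)
    (Ω : Set (EuclideanSpace ℝ (Fin m))) :
    Set (MeasureTheory.Lp ℝ p (MeasureTheory.volume.restrict Ω)) :=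
  {f | ∃ F ∈ S, f =ᵐ[MeasureTheory.volume.restrict Ω] F}

/-- `S` is a universal approximator in `Lᵖ(Ω)`: the closure of `S ∩ Lᵖ(Ω)`, in the norm topology
of `Lᵖ(Ω)`, is all of `Lᵖ(Ω)`. -/
def IsUniversalApproximator {m : ℕ} (S : Set (EuclideanSpace ℝ (Fin m) → ℝ)) (p : ENNReal)
    [Fact (1 ≤ p)] (Ω : Set (EuclideanSpace ℝ (Fin m))) : Prop :=
  closure (interLp S p Ω) = Set.univ

end

end ShallowNet

/-! Approximation takes place in the supremum norm on the strip weighted by 1/`decay`. As `decay`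
lies in Lᵖ for p ≥ 2, convergence in this norm controls the Lᵖ error; as it decays more slowly than
1/|t|, a bump of height 1/R on [-R, R] tends to 0 in this norm as R → ∞.

Combinations of φ rescaled by a large factor, with the linear growth cancelled, converge to
compactly supported piecewise linear functions of t + ⟨b, y⟩. Hence every g(t + ⟨b, y⟩) with g
continuous and compactly supported is a limit of networks (`ridge_mem_approx`). Differentiating f(t
+ ⟨b, y⟩) in the parameter bᵢ brings down a factor yᵢ and yields yᵢ f'(t + ⟨b, y⟩)
(`IsRidgeMultiplier.mul_deriv_mem`). Such an f' has integral zero, but any g becomes a derivative of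
this kind after subtracting a wide bump of height O(1/R), which is negligible in the weighted norm
(`exists_primitive`). Thus multiplication by yᵢ can be iterated (`IsRidgeMultiplier.mul_coord`), and
b = 0 gives all polynomials in y times compactly supported functions of t. Stone–Weierstrass then
reaches all of C_c, which is dense in Lᵖ. -/

namespace ShallowNet

noncomputable section

open Set Filter Topology MeasureTheory

/-! ### The weight and its behaviour under shears -/

/-- The weight `(1 + |t|) ^ (-3/4)`, which lies in `Lᵖ(ℝ)` for all `p ≥ 2` and decays more slowly
than `1 / t`. -/
def decay (t : ℝ) : ℝ := (1 + |t|) ^ (-(3 / 4) : ℝ)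

theorem decay_pos (t : ℝ) : 0 < decay t := Real.rpow_pos_of_pos (by positivity) _

theorem decay_add_le (t s : ℝ) : decay (t + s) ≤ (1 + |s|) * decay t := by
  unfold decay
  have hX : 0 < 1 + |t + s| := by positivity
  have hY : 0 < 1 + |s| := by positivity
  have hZ : 0 < 1 + |t| := by positivity
  have h : 1 + |t| ≤ (1 + |t + s|) * (1 + |s|) := by
    have : |t| ≤ |t + s| + |s| := by
      have := abs_sub (t + s) s
      simpa using this
    nlinarith [abs_nonneg (t + s), abs_nonneg s]
  have h1 := Real.rpow_le_rpow_of_nonpos hZ h (by norm_num : (-(3 / 4) : ℝ) ≤ 0)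
  rw [Real.mul_rpow hX.le hY.le] at h1
  -- The product is (1 + |s|)^(1/4) ≥ 1; this slack leaves the simple constant 1 + |s|.
  have h2 : (1 + |s|) * (1 + |s|) ^ (-(3 / 4) : ℝ) ≥ 1 := by
    nth_rewrite 1 [← Real.rpow_one (1 + |s|)]
    rw [← Real.rpow_add hY]
    exact Real.one_le_rpow (by linarith [abs_nonneg s]) (by norm_num)
  have h3 : 0 < (1 + |t + s|) ^ (-(3 / 4) : ℝ) := Real.rpow_pos_of_pos hX _
  calc (1 + |t + s|) ^ (-(3 / 4) : ℝ)
      ≤ (1 + |t + s|) ^ (-(3 / 4) : ℝ) * ((1 + |s|) * (1 + |s|) ^ (-(3 / 4) : ℝ)) :=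
        le_mul_of_one_le_right h3.le h2
    _ = (1 + |s|) * ((1 + |t + s|) ^ (-(3 / 4) : ℝ) * (1 + |s|) ^ (-(3 / 4) : ℝ)) := by ring
    _ ≤ _ := by gcongr

theorem one_le_mul_decay {t T : ℝ} (h : |t| ≤ T) : 1 ≤ (1 + T) ^ (3 / 4 : ℝ) * decay t := by
  have hZ : 0 < 1 + |t| := by positivity
  calc (1 : ℝ) = (1 + |t|) ^ (3 / 4 : ℝ) * (1 + |t|) ^ (-(3 / 4) : ℝ) := by
        rw [← Real.rpow_add hZ]; norm_num
    _ ≤ _ := by unfold decay; gcongr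

theorem inv_le_decay (t : ℝ) : (1 + |t|)⁻¹ ≤ decay t := by
  rw [← Real.rpow_neg_one]
  exact Real.rpow_le_rpow_of_exponent_le (by linarith [abs_nonneg t]) (by norm_num)

/-- A function of absolute value at most `ε` vanishing outside `[-T, T]` is dominated by a multiple
of `decay`. -/
theorem abs_le_mul_decay {h : ℝ → ℝ} {ε T : ℝ} (hε : ∀ s, |h s| ≤ ε) (hT0 : 0 ≤ T)
    (hT : ∀ s, T < |s| → h s = 0)
    (s : ℝ) : |h s| ≤ ε * (1 + T) ^ (3 / 4 : ℝ) * decay s := by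
  have hε0 : 0 ≤ ε := (abs_nonneg _).trans (hε 0)
  rcases le_or_gt |s| T with hs | hs
  · calc |h s| ≤ ε * 1 := by simpa using hε s
      _ ≤ ε * ((1 + T) ^ (3 / 4 : ℝ) * decay s) := by gcongr; exact one_le_mul_decay hs
      _ = _ := by ring
  · rw [hT s hs, abs_zero]
    have := decay_pos s
    positivity

variable {n : ℕ}

/-- A bound for the coordinates of the shear `(t, y) ↦ t + b ⬝ᵥ y` over the unit cube. -/
theorem abs_dotProduct_le (b : Fin n → ℝ) {y : Fin n → ℝ} (hy : y ∈ Icc (0 : Fin n → ℝ) 1) :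
    |b ⬝ᵥ y| ≤ ∑ i, |b i| := by
  refine (Finset.abs_sum_le_sum_abs _ _).trans (Finset.sum_le_sum fun i _ => ?_)
  rw [abs_mul, abs_of_nonneg (hy.1 i)]
  exact mul_le_of_le_one_right (abs_nonneg _) (hy.2 i)

theorem decay_ridge_le (b : Fin n → ℝ) {y : Fin n → ℝ} (hy : y ∈ Icc (0 : Fin n → ℝ) 1) (t : ℝ) :
    decay (t + b ⬝ᵥ y) ≤ (1 + ∑ i, |b i|) * decay t := by
  refine (decay_add_le _ _).trans ?_
  have := decay_pos t
  gcongr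
  exact abs_dotProduct_le b hy

/-! ### Ridge functions and weighted uniform approximation -/

/-- The linear span of the ridge functions `(t, y) ↦ φ(a t + ⟨b, y⟩ + c)`. -/
def ridgeSpan (φ : ℝ → ℝ) (n : ℕ) : Submodule ℝ (ℝ × (Fin n → ℝ) → ℝ) :=
  Submodule.span ℝ {F | ∃ (a : ℝ) (b : Fin n → ℝ) (c : ℝ), F = fun x => φ (a * x.1 + b ⬝ᵥ x.2 + c)}

/-- The functions on `ℝ × [0, 1]ⁿ` that are limits of elements of `S` in the supremum norm weighted
by `1 / decay`. -/
def approx (S : Submodule ℝ (ℝ × (Fin n → ℝ) → ℝ)) : Submodule ℝ (ℝ × (Fin n → ℝ) → ℝ) where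
  carrier := {F | ∀ ε > 0, ∃ N ∈ S, ∀ x, x.2 ∈ Icc (0 : Fin n → ℝ) 1 →
    |F x - N x| ≤ ε * decay x.1}
  zero_mem' := fun ε hε => ⟨0, S.zero_mem, fun x _ => by
    simpa using mul_nonneg hε.le (decay_pos x.1).le⟩
  add_mem' := by
    intro F G hF hG ε hε
    obtain ⟨N, hN, hFN⟩ := hF (ε / 2) (by positivity)
    obtain ⟨P, hP, hGP⟩ := hG (ε / 2) (by positivity)
    refine ⟨N + P, S.add_mem hN hP, fun x hx => ?_⟩
    calc |(F + G) x - (N + P) x| = |(F x - N x) + (G x - P x)| := by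
          simp only [Pi.add_apply]; congr 1; ring
      _ ≤ |F x - N x| + |G x - P x| := abs_add_le _ _
      _ ≤ ε / 2 * decay x.1 + ε / 2 * decay x.1 := add_le_add (hFN x hx) (hGP x hx)
      _ = ε * decay x.1 := by ring
  smul_mem' := by
    intro c F hF ε hε
    obtain ⟨N, hN, hFN⟩ := hF (ε / (|c| + 1)) (by positivity)
    refine ⟨c • N, S.smul_mem c hN, fun x hx => ?_⟩
    have h0 := decay_pos x.1
    calc |(c • F) x - (c • N) x| = |c| * |F x - N x| := by
          rw [← abs_mul]; simp only [Pi.smul_apply, smul_eq_mul]; congr 1; ring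
      _ ≤ (|c| + 1) * (ε / (|c| + 1) * decay x.1) := by
          gcongr
          · linarith
          · exact hFN x hx
      _ = ε * decay x.1 := by field_simp

/-- `approx S` is closed under weighted uniform limits, where the error may be controlled up to a
constant factor. -/
theorem mem_approx_of_limit {S : Submodule ℝ (ℝ × (Fin n → ℝ) → ℝ)} {F : ℝ × (Fin n → ℝ) → ℝ}
    (C : ℝ) (h : ∀ ε > 0, ∃ G ∈ approx S, ∀ x, x.2 ∈ Icc (0 : Fin n → ℝ) 1 →
      |F x - G x| ≤ ε * C * decay x.1) : F ∈ approx S := by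
  intro ε hε
  obtain ⟨G, hG, hFG⟩ := h (ε / 2 / (|C| + 1)) (by positivity)
  obtain ⟨N, hN, hGN⟩ := hG (ε / 2) (by positivity)
  refine ⟨N, hN, fun x hx => ?_⟩
  have h0 := decay_pos x.1
  have h1 : ε / 2 / (|C| + 1) * C ≤ ε / 2 := by
    rw [div_mul_eq_mul_div, div_le_iff₀ (by positivity)]
    gcongr
    linarith [le_abs_self C]
  calc |F x - N x| ≤ |F x - G x| + |G x - N x| := abs_sub_le _ _ _
    _ ≤ ε / 2 * decay x.1 + ε / 2 * decay x.1 :=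
        add_le_add ((hFG x hx).trans (by gcongr)) (hGN x hx)
    _ = ε * decay x.1 := by ring

theorem le_approx (S : Submodule ℝ (ℝ × (Fin n → ℝ) → ℝ)) : S ≤ approx S :=
  fun F hF ε hε => ⟨F, hF, fun x _ => by simpa using mul_nonneg hε.le (decay_pos x.1).le⟩

/-! ### The four activation functions -/

/-- Functions which agree with a multiple of the rectified linear unit up to a linear function and a
remainder whose rescaled differences are dominated by `decay`. -/
def IsReLULike (φ : ℝ → ℝ) : Prop :=
  ∃ a c : ℝ, c ≠ 0 ∧ ∀ u v : ℝ, ∃ C : ℝ, ∀ l : ℝ, 1 ≤ l → ∀ t : ℝ,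
    |(φ (l * (t - u)) - (a * (l * (t - u)) + c * reLU (l * (t - u)))) -
      (φ (l * (t - v)) - (a * (l * (t - v)) + c * reLU (l * (t - v))))| ≤ C * decay t

theorem isReLULike_leakyReLU {α : ℝ} (hα : α ≠ 1) : IsReLULike (leakyReLU α) := by
  refine ⟨α, 1 - α, sub_ne_zero.2 hα.symm, fun u v => ⟨0, fun l _ t => ?_⟩⟩
  have h (x : ℝ) : leakyReLU α x - (α * x + (1 - α) * reLU x) = 0 := by
    unfold leakyReLU reLU; split_ifs <;> ring
  simp only [h]; simp

/-- The step term `d` is invariant under positive rescaling, so its contributions at u and v cancel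
for |t| > |u| + |v|. The rest is at most a multiple of 1/(1 + |x|), and stretching the argument by l
≥ 1 only improves this bound. -/
theorem isReLULike_of_remainder {φ : ℝ → ℝ} (a c d C : ℝ) (hc : c ≠ 0)
    (h : ∀ x, |φ x - (a * x + c * reLU x + if x ≤ 0 then d else 0)| ≤ C * (1 + |x|)⁻¹) :
    IsReLULike φ := by
  have hC : 0 ≤ C := by simpa using (abs_nonneg _).trans (h 0)
  have key (u l t : ℝ) (hl : 1 ≤ l) : |φ (l * (t - u)) - (a * (l * (t - u)) +
      c * reLU (l * (t - u)) + if t ≤ u then d else 0)| ≤ C * (1 + |u|) * decay t := by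
    have h1 := h (l * (t - u))
    have h2 : (l * (t - u) ≤ 0) = (t ≤ u) := by
      rw [← neg_nonneg, ← mul_neg, mul_nonneg_iff_of_pos_left (by linarith), neg_nonneg,
        sub_nonpos]
    simp only [h2] at h1
    refine h1.trans ?_
    have h3 : (1 + |l * (t - u)|)⁻¹ ≤ (1 + |t - u|)⁻¹ := by
      have h4 : |t - u| ≤ |l * (t - u)| := by
        rw [abs_mul, abs_of_pos (by linarith : 0 < l)]
        exact le_mul_of_one_le_left (abs_nonneg _) hl
      exact inv_anti₀ (by positivity) (by linarith)
    calc C * (1 + |l * (t - u)|)⁻¹ ≤ C * decay (t + -u) := by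
          gcongr; exact h3.trans (inv_le_decay _)
      _ ≤ C * ((1 + |-u|) * decay t) := by gcongr; exact decay_add_le _ _
      _ = _ := by rw [abs_neg]; ring
  refine ⟨a, c, hc, fun u v => ⟨C * (1 + |u|) + C * (1 + |v|) +
    |d| * (1 + (|u| + |v|)) ^ (3 / 4 : ℝ), fun l hl t => ?_⟩⟩
  have h1 := key u l t hl
  have h2 := key v l t hl
  have h3 : |(if t ≤ u then d else 0) - (if t ≤ v then d else 0)| ≤
      |d| * (1 + (|u| + |v|)) ^ (3 / 4 : ℝ) * decay t := by
    refine abs_le_mul_decay (h := fun t => (if t ≤ u then d else 0) - (if t ≤ v then d else 0))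
      (fun s => ?_) (by positivity) (fun s hs => ?_) t
    · split_ifs <;> simp
    · rcases lt_abs.1 hs with h | h
      · rw [if_neg (by linarith [le_abs_self u, abs_nonneg v]),
          if_neg (by linarith [le_abs_self v, abs_nonneg u]), sub_zero]
      · rw [if_pos (by linarith [neg_abs_le u, abs_nonneg v]),
          if_pos (by linarith [neg_abs_le v, abs_nonneg u]), sub_self]
  rw [add_mul, add_mul]
  rw [abs_le] at *
  constructor <;> linarith

theorem isReLULike_reLU : IsReLULike reLU :=
  isReLULike_of_remainder 0 1 0 0 one_ne_zero fun x => by simp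

theorem isReLULike_elu (α : ℝ) : IsReLULike (elu α) := by
  -- On x ≤ 0 the function tends to -α at -∞, with remainder α eˣ, and eˣ ≤ 1/(1 + |x|) there.
  refine isReLULike_of_remainder 0 1 (-α) |α| one_ne_zero fun x => ?_
  unfold elu reLU
  rcases lt_or_ge 0 x with hx | hx
  · rw [if_pos hx, if_pos hx, if_neg (not_le.2 hx)]
    simp; positivity
  · rw [if_neg (not_lt.2 hx), if_neg (not_lt.2 hx), if_pos hx]
    have : α * (Real.exp x - 1) - (0 * x + 1 * 0 + -α) = α * Real.exp x := by ring
    rw [this, abs_mul, Real.abs_exp, abs_of_nonpos hx, ← inv_inv (Real.exp x), ← Real.exp_neg]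
    gcongr <;> linarith [Real.add_one_le_exp (-x)]

theorem isReLULike_softplus : IsReLULike softplus := by
  refine isReLULike_of_remainder 0 1 0 1 one_ne_zero fun x => ?_
  have h : softplus x - reLU x = Real.log (1 + Real.exp (-|x|)) := by
    unfold softplus reLU
    rcases lt_or_ge 0 x with hx | hx
    · rw [if_pos hx, abs_of_pos hx]
      nth_rewrite 2 [← Real.log_exp x]
      rw [← Real.log_div (by positivity) (by positivity), add_div, div_self (by positivity),
        Real.exp_neg, one_div]
    · rw [if_neg (not_lt.2 hx), abs_of_nonpos hx, neg_neg, sub_zero, add_comm]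
  have h0 : 0 ≤ Real.log (1 + Real.exp (-|x|)) := Real.log_nonneg (by linarith [Real.exp_pos (-|x|)])
  simp only [ite_self, add_zero, zero_mul, zero_add, one_mul, h, abs_of_nonneg h0]
  calc Real.log (1 + Real.exp (-|x|)) ≤ Real.exp (-|x|) := by
        have := Real.log_le_sub_one_of_pos (x := 1 + Real.exp (-|x|)) (by positivity)
        linarith
    _ = (Real.exp |x|)⁻¹ := Real.exp_neg _
    _ ≤ _ := by
        gcongr
        linarith [Real.add_one_le_exp |x|]

theorem measurable_reLU : Measurable reLU :=
  Measurable.ite measurableSet_Ioi measurable_id measurable_const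

theorem measurable_elu (α : ℝ) : Measurable (elu α) :=
  Measurable.ite measurableSet_Ioi measurable_id (by fun_prop)

theorem measurable_softplus : Measurable softplus := by unfold softplus; fun_prop

theorem measurable_leakyReLU (α : ℝ) : Measurable (leakyReLU α) :=
  Measurable.ite measurableSet_Ioi measurable_id (by fun_prop)

/-! ### From networks to piecewise linear ridge functions -/

theorem reLU_of_nonneg {x : ℝ} (h : 0 ≤ x) : reLU x = x := by
  unfold reLU; split_ifs with h'
  · rfl
  · linarith

theorem reLU_of_nonpos {x : ℝ} (h : x ≤ 0) : reLU x = 0 := if_neg (not_lt.2 h)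

theorem reLU_mul {l : ℝ} (hl : 0 ≤ l) (x : ℝ) : reLU (l * x) = l * reLU x := by
  rcases le_total 0 x with h | h
  · rw [reLU_of_nonneg h, reLU_of_nonneg (mul_nonneg hl h)]
  · rw [reLU_of_nonpos h, reLU_of_nonpos (mul_nonpos_of_nonneg_of_nonpos hl h), mul_zero]

theorem ridge_mem_ridgeSpan (φ : ℝ → ℝ) (b : Fin n → ℝ) (l u : ℝ) :
    (fun x : ℝ × (Fin n → ℝ) => φ (l * (x.1 + b ⬝ᵥ x.2 - u))) ∈ ridgeSpan φ n := by
  refine Submodule.subset_span ⟨l, l • b, -(l * u), ?_⟩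
  ext x
  rw [smul_dotProduct, smul_eq_mul]
  congr 1; ring

/-- Compactly supported piecewise linear ridge functions are limits of `φ`-networks. -/
theorem sum_reLU_mem_approx {φ : ℝ → ℝ} (hφ : IsReLULike φ) (b : Fin n → ℝ) {ι : Type*}
    (s : Finset ι) (κ u v : ι → ℝ) (h0 : ∑ i ∈ s, κ i * (v i - u i) = 0) :
    (fun x : ℝ × (Fin n → ℝ) => ∑ i ∈ s, κ i *
      (reLU (x.1 + b ⬝ᵥ x.2 - u i) - reLU (x.1 + b ⬝ᵥ x.2 - v i))) ∈ approx (ridgeSpan φ n) := by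
  obtain ⟨a, c, hc, hq⟩ := hφ
  choose C hC using hq
  refine mem_approx_of_limit ((∑ i ∈ s, |κ i| * C (u i) (v i)) * (1 + ∑ i, |b i|) / |c|)
    fun ε hε => ?_
  -- By homogeneity of `reLU`, dividing by l * c restores the rectifier at scale one, while the
  -- remainder, bounded uniformly in l, shrinks like 1/l.
  obtain ⟨l, hl1, hlε⟩ : ∃ l : ℝ, 1 ≤ l ∧ 1 / l ≤ ε :=
    ⟨max 1 (1 / ε), le_max_left _ _, by
      rw [one_div_le (by positivity) hε]; exact le_max_right _ _⟩
  have hl : 0 < l := by linarith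
  refine ⟨∑ i ∈ s, (κ i / (l * c)) • ((fun x => φ (l * (x.1 + b ⬝ᵥ x.2 - u i))) -
    fun x => φ (l * (x.1 + b ⬝ᵥ x.2 - v i))), le_approx _ <| Submodule.sum_mem _ fun i _ =>
      Submodule.smul_mem _ _ (Submodule.sub_mem _ (ridge_mem_ridgeSpan φ b l _)
        (ridge_mem_ridgeSpan φ b l _)), fun x hx => ?_⟩
  set t := x.1 + b ⬝ᵥ x.2
  -- The linear parts leave only a constant in t; these constants sum to zero by `h0`.
  have hterm (i : ι) : κ i * (reLU (t - u i) - reLU (t - v i)) -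
      κ i / (l * c) * (φ (l * (t - u i)) - φ (l * (t - v i))) =
      -(κ i / (l * c) * ((φ (l * (t - u i)) - (a * (l * (t - u i)) + c * reLU (l * (t - u i)))) -
      (φ (l * (t - v i)) - (a * (l * (t - v i)) + c * reLU (l * (t - v i)))))) -
      a / c * (κ i * (v i - u i)) := by
    rw [reLU_mul hl.le, reLU_mul hl.le]
    field_simp
    ring
  have hsum : ∑ i ∈ s, |κ i| * C (u i) (v i) * decay t ≤
      (∑ i ∈ s, |κ i| * C (u i) (v i)) * ((1 + ∑ i, |b i|) * decay x.1) := by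
    rw [← Finset.sum_mul]
    refine mul_le_mul_of_nonneg_left (decay_ridge_le b hx x.1) ?_
    refine Finset.sum_nonneg fun i _ => mul_nonneg (abs_nonneg _) ?_
    have := (abs_nonneg _).trans (hC (u i) (v i) l hl1 0)
    exact nonneg_of_mul_nonneg_left this (decay_pos 0)
  simp only [Finset.sum_apply, Pi.smul_apply, Pi.sub_apply, smul_eq_mul]
  rw [← Finset.sum_sub_distrib, Finset.sum_congr rfl fun i _ => hterm i, Finset.sum_sub_distrib,
    ← Finset.mul_sum, h0, mul_zero, sub_zero]
  calc _ ≤ ∑ i ∈ s, 1 / (l * |c|) * (|κ i| * C (u i) (v i) * decay t) := by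
        refine (Finset.abs_sum_le_sum_abs _ _).trans (Finset.sum_le_sum fun i _ => ?_)
        rw [abs_neg, abs_mul, abs_div, abs_mul, abs_of_pos hl]
        calc _ ≤ |κ i| / (l * |c|) * (C (u i) (v i) * decay t) := by
              gcongr; exact hC _ _ l hl1 t
          _ = _ := by ring
    _ = 1 / l * (1 / |c| * ∑ i ∈ s, |κ i| * C (u i) (v i) * decay t) := by
        rw [← Finset.mul_sum, ← mul_assoc, one_div_mul_one_div]
    _ ≤ ε * (1 / |c| * ((∑ i ∈ s, |κ i| * C (u i) (v i)) * ((1 + ∑ i, |b i|) * decay x.1))) := by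
        refine mul_le_mul hlε (by gcongr) ?_ hε.le
        refine mul_nonneg (by positivity) (Finset.sum_nonneg fun i _ => ?_)
        have := (abs_nonneg _).trans (hC (u i) (v i) l hl1 t)
        rw [mul_assoc]
        exact mul_nonneg (abs_nonneg _) this
    _ = _ := by ring

/-! ### Continuous compactly supported ridge functions -/

/-- Piecewise linear interpolation of `g` at the nodes `a + i δ`. -/
def interpolant (g : ℝ → ℝ) (a δ : ℝ) (K : ℕ) (t : ℝ) : ℝ :=
  ∑ i ∈ Finset.range K, (g (a + (i + 1) * δ) - g (a + i * δ)) / δ *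
    (reLU (t - (a + i * δ)) - reLU (t - (a + (i + 1) * δ)))

theorem interpolant_of_le {a δ t : ℝ} (hδ : 0 < δ) (g : ℝ → ℝ) (K : ℕ) (ht : t ≤ a) :
    interpolant g a δ K t = 0 := by
  refine Finset.sum_eq_zero fun i _ => ?_
  have : 0 ≤ i * δ := by positivity
  rw [reLU_of_nonpos (by linarith), reLU_of_nonpos (by linarith), sub_self, mul_zero]

theorem interpolant_of_ge {a δ t : ℝ} (hδ : 0 < δ) (g : ℝ → ℝ) (K : ℕ) (ht : a + K * δ ≤ t) :
    interpolant g a δ K t = g (a + K * δ) - g a := by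
  induction K with
  | zero => simp [interpolant]
  | succ K ih =>
    push_cast at ht ⊢
    have h1 := ih (by linarith)
    unfold interpolant at *
    rw [Finset.sum_range_succ, h1, reLU_of_nonneg (by linarith), reLU_of_nonneg (by linarith)]
    field_simp
    ring

/-- In the cell containing t, both g and its interpolant differ from the value at the left node by
at most ε. -/
theorem abs_interpolant_sub_le {a δ ε t : ℝ} (hδ : 0 < δ) {g : ℝ → ℝ}
    (hg : ∀ s s', |s - s'| ≤ δ → |g s - g s'| ≤ ε) (K : ℕ) (ha : a ≤ t) (ht : t ≤ a + K * δ) :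
    |interpolant g a δ K t - (g t - g a)| ≤ 2 * ε := by
  have hε : 0 ≤ ε := by simpa using hg 0 0 (by simpa using hδ.le)
  induction K with
  | zero =>
    have : t = a := by simp at ht; linarith
    simp [interpolant, this, hε]
  | succ K ih =>
    push_cast at ht
    rcases le_total t (a + K * δ) with h | h
    · have h1 := ih h
      unfold interpolant at *
      rwa [Finset.sum_range_succ, reLU_of_nonpos (by linarith), reLU_of_nonpos (by linarith),
        sub_self, mul_zero, add_zero]
    · have h1 := interpolant_of_ge hδ g K h
      unfold interpolant at *
      rw [Finset.sum_range_succ, h1, reLU_of_nonneg (by linarith), reLU_of_nonpos (by linarith)]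
      have h2 := hg (a + K * δ) t (by rw [abs_le]; constructor <;> linarith)
      have h3 := hg (a + (K + 1) * δ) (a + K * δ) (by
        rw [abs_le]; constructor <;> linarith)
      have h4 : |(g (a + (K + 1) * δ) - g (a + K * δ)) / δ * (t - (a + K * δ))| ≤ ε := by
        rw [abs_mul, abs_div, abs_of_pos hδ, abs_of_nonneg (sub_nonneg.2 h)]
        rw [div_mul_eq_mul_div, div_le_iff₀ hδ]
        gcongr
        linarith
      rw [sub_zero]
      rw [abs_le] at *
      constructor <;> linarith

theorem exists_forall_lt_abs_eq_zero {g : ℝ → ℝ} (hg : HasCompactSupport g) :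
    ∃ T, 0 < T ∧ ∀ s, T ≤ |s| → g s = 0 := by
  obtain ⟨T, hT⟩ := hg.isCompact.isBounded.exists_norm_le
  refine ⟨|T| + 1, by positivity, fun s hs => image_eq_zero_of_notMem_tsupport fun h => ?_⟩
  have := hT s h
  rw [Real.norm_eq_abs] at this
  linarith [le_abs_self T]

theorem hasCompactSupport_of_forall_lt_abs {g : ℝ → ℝ} {T : ℝ} (h : ∀ s, T < |s| → g s = 0) :
    HasCompactSupport g :=
  HasCompactSupport.intro (isCompact_Icc (a := -T) (b := T)) fun x hx => h x (by
    by_contra! hx'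
    exact hx (abs_le.1 hx'))

theorem ridge_mem_approx {φ : ℝ → ℝ} (hφ : IsReLULike φ) {g : ℝ → ℝ} (hg : Continuous g)
    (hg' : HasCompactSupport g) (b : Fin n → ℝ) :
    (fun x : ℝ × (Fin n → ℝ) => g (x.1 + b ⬝ᵥ x.2)) ∈ approx (ridgeSpan φ n) := by
  obtain ⟨T, hT0, hT⟩ := exists_forall_lt_abs_eq_zero hg'
  refine mem_approx_of_limit (2 * (1 + T) ^ (3 / 4 : ℝ) * (1 + ∑ i, |b i|)) fun ε hε => ?_
  obtain ⟨d, hd, hd'⟩ := Metric.uniformContinuous_iff.1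
    (hg'.uniformContinuous_of_continuous hg) ε hε
  obtain ⟨K, hK⟩ := exists_nat_gt (2 * T / d)
  have hK0 : (0 : ℝ) < K := lt_of_le_of_lt (by positivity) hK
  set δ := 2 * T / K with hδ
  have hδ0 : 0 < δ := by positivity
  have hδd : δ < d := by rwa [hδ, div_lt_comm₀ hK0 hd]
  have hKδ : K * δ = 2 * T := by rw [hδ]; field_simp
  have hosc : ∀ s s', |s - s'| ≤ δ → |g s - g s'| ≤ ε := fun s s' h =>
    (hd' (by rw [Real.dist_eq]; exact h.trans_lt hδd)).le
  have hl : g (-T) = 0 := hT _ (by rw [abs_neg]; exact le_abs_self T)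
  have hr : g (-T + K * δ) = 0 := hT _ (by rw [hKδ]; exact le_abs.2 (Or.inl (by linarith)))
  refine ⟨fun x => interpolant g (-T) δ K (x.1 + b ⬝ᵥ x.2), ?_, fun x hx => ?_⟩
  -- Slope times cell width is the increment of g, so the sum telescopes to g(T) - g(-T) = 0.
  · refine sum_reLU_mem_approx hφ b (Finset.range K) _ _ _ ?_
    have h1 (i : ℕ) : (g (-T + (i + 1) * δ) - g (-T + i * δ)) / δ *
        (-T + (i + 1) * δ - (-T + i * δ)) =
        g (-T + (i + 1 : ℕ) * δ) - g (-T + i * δ) := by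
      push_cast; field_simp; ring
    rw [Finset.sum_congr rfl fun i _ => h1 i,
      Finset.sum_range_sub (fun i : ℕ => g (-T + i * δ)), hr]
    simp [hl]
  · have hbd := abs_le_mul_decay (h := fun s => g s - interpolant g (-T) δ K s) (ε := 2 * ε)
      (T := T) (fun s => ?_) hT0.le (fun s hs => ?_) (x.1 + b ⬝ᵥ x.2)
    · refine hbd.trans ?_
      calc _ ≤ 2 * ε * (1 + T) ^ (3 / 4 : ℝ) * ((1 + ∑ i, |b i|) * decay x.1) := by
            gcongr; exact decay_ridge_le b hx _
        _ = _ := by ring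
    · rcases le_total s (-T) with h | h
      · rw [interpolant_of_le hδ0 g K h, hT s (le_abs.2 (Or.inr (by linarith)))]
        simpa using hε.le
      rcases le_total (-T + K * δ) s with h' | h'
      · rw [interpolant_of_ge hδ0 g K h', hl, hr, hT s (le_abs.2 (Or.inl (by linarith)))]
        simpa using hε.le
      · have := abs_interpolant_sub_le hδ0 hosc K h h'
        rwa [hl, sub_zero, abs_sub_comm] at this
    · rw [hT s hs.le, zero_sub, neg_eq_zero]
      rcases lt_abs.1 hs with h | h
      · rw [interpolant_of_ge hδ0 g K (by linarith), hl, hr, sub_zero]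
      · rw [interpolant_of_le hδ0 g K (by linarith)]

/-! ### Multiplication by coordinates -/

/-- Bounded functions `m` on the unit cube such that the products of `m` with all continuous
compactly supported ridge functions are limits of elements of `S`. -/
def IsRidgeMultiplier (S : Submodule ℝ (ℝ × (Fin n → ℝ) → ℝ)) (m : (Fin n → ℝ) → ℝ) : Prop :=
  (∃ D, ∀ y ∈ Icc (0 : Fin n → ℝ) 1, |m y| ≤ D) ∧
    ∀ g : ℝ → ℝ, Continuous g → HasCompactSupport g → ∀ b : Fin n → ℝ,
      (fun x : ℝ × (Fin n → ℝ) => m x.2 * g (x.1 + b ⬝ᵥ x.2)) ∈ approx S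

/-- The mean value inequality for x ↦ f x - x * k s, whose derivative k x - k s is at most ε in
absolute value on the interval. -/
theorem abs_sub_sub_mul_le {f k : ℝ → ℝ} {δ ε : ℝ} (hf : ∀ s, HasDerivAt f (k s) s)
    (hk : ∀ s s', |s - s'| ≤ δ → |k s - k s'| ≤ ε) {s h : ℝ} (h0 : 0 ≤ h) (hδ : h ≤ δ) :
    |f (s + h) - f s - h * k s| ≤ ε * h := by
  have := (convex_Icc s (s + h)).norm_image_sub_le_of_norm_hasDerivWithin_le
    (f := fun x => f x - x * k s) (f' := fun x => k x - k s) (C := ε) (x := s) (y := s + h)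
    (fun x _ => by
      have := (hf x).sub ((hasDerivAt_id x).mul_const (k s))
      rw [one_mul] at this
      exact this.hasDerivWithinAt)
    (fun x hx => hk x s (by rw [abs_le]; constructor <;> linarith [hx.1, hx.2]))
    ⟨le_rfl, by linarith⟩ ⟨by linarith, le_rfl⟩
  rw [Real.norm_eq_abs, Real.norm_eq_abs, add_sub_cancel_left, abs_of_nonneg h0] at this
  convert this using 2
  ring

theorem abs_sub_difference_quotient_le {f k : ℝ → ℝ} {T δ ε r : ℝ} (hT0 : 0 ≤ T)
    (hf : ∀ s, HasDerivAt f (k s) s) (hfT : ∀ s, T < |s| → f s = 0)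
    (hkT : ∀ s, T < |s| → k s = 0) (hosc : ∀ s s', |s - s'| ≤ δ → |k s - k s'| ≤ ε)
    (hε : 0 ≤ ε) (hδ0 : 0 < δ) (hδ1 : δ ≤ 1) (hr0 : 0 ≤ r) (hr1 : r ≤ 1) (t : ℝ) :
    |r * k t - δ⁻¹ * (f (t + δ * r) - f t)| ≤ ε * (1 + (T + 1)) ^ (3 / 4 : ℝ) * decay t := by
  refine abs_le_mul_decay (h := fun s => r * k s - δ⁻¹ * (f (s + δ * r) - f s))
    (fun s => ?_) (by linarith) (fun s hs => ?_) t
  · have h2 := abs_sub_sub_mul_le (s := s) hf hosc (h := δ * r) (by positivity)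
      (mul_le_of_le_one_right hδ0.le hr1)
    have h3 : r * k s - δ⁻¹ * (f (s + δ * r) - f s) =
        -(δ⁻¹ * (f (s + δ * r) - f s - δ * r * k s)) := by
      field_simp; ring
    rw [h3, abs_neg, abs_mul, abs_of_pos (inv_pos.2 hδ0)]
    calc δ⁻¹ * |f (s + δ * r) - f s - δ * r * k s| ≤ δ⁻¹ * (ε * (δ * r)) := by gcongr
      _ = ε * r := by field_simp
      _ ≤ ε := mul_le_of_le_one_right hε hr1
  · have h2 : 0 ≤ δ * r := by positivity
    have h3 : δ * r ≤ 1 := mul_le_one₀ hδ1 hr0 hr1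
    -- The shift δ r lies in [0, 1]; this is why the support bound is enlarged to T + 1.
    have h4 : T < |s + δ * r| := by
      rcases lt_abs.1 hs with h | h
      · exact lt_abs.2 (Or.inl (by linarith))
      · exact lt_abs.2 (Or.inr (by linarith))
    rw [hkT s (by linarith), hfT s (by linarith), hfT _ h4]
    simp

/-- Differentiation of ridge functions with respect to the direction. -/
theorem IsRidgeMultiplier.mul_deriv_mem {S : Submodule ℝ (ℝ × (Fin n → ℝ) → ℝ)}
    {m : (Fin n → ℝ) → ℝ} (hm : IsRidgeMultiplier S m) {f k : ℝ → ℝ} {T : ℝ} (hT0 : 0 ≤ T)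
    (hf : ∀ s, HasDerivAt f (k s) s) (hk : Continuous k) (hfT : ∀ s, T < |s| → f s = 0)
    (hkT : ∀ s, T < |s| → k s = 0) (i : Fin n) (b : Fin n → ℝ) :
    (fun x : ℝ × (Fin n → ℝ) => m x.2 * x.2 i * k (x.1 + b ⬝ᵥ x.2)) ∈ approx S := by
  obtain ⟨⟨D, hD⟩, hm⟩ := hm
  refine mem_approx_of_limit (D * ((1 + (T + 1)) ^ (3 / 4 : ℝ) * (1 + ∑ i, |b i|))) fun ε hε => ?_
  obtain ⟨d, hd, hd'⟩ := Metric.uniformContinuous_iff.1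
    ((hasCompactSupport_of_forall_lt_abs hkT).uniformContinuous_of_continuous hk) ε hε
  obtain ⟨δ, hδ0, hδ1, hδd⟩ : ∃ δ, 0 < δ ∧ δ ≤ 1 ∧ δ < d :=
    ⟨min 1 (d / 2), by positivity, min_le_left _ _, (min_le_right _ _).trans_lt (by linarith)⟩
  have hosc : ∀ s s', |s - s'| ≤ δ → |k s - k s'| ≤ ε := fun s s' h =>
    (hd' (by rw [Real.dist_eq]; exact h.trans_lt hδd)).le
  have hfc : Continuous f := continuous_iff_continuousAt.2 fun s => (hf s).continuousAt
  have hfs := hasCompactSupport_of_forall_lt_abs hfT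
  -- The difference quotient in bᵢ: moving b by δ in direction i shifts the argument by δ yᵢ.
  have hG := (approx S).smul_mem δ⁻¹ ((approx S).sub_mem (hm f hfc hfs (b + Pi.single i δ))
    (hm f hfc hfs b))
  refine ⟨_, hG, fun x hx => ?_⟩
  have hy0 : 0 ≤ x.2 i := hx.1 i
  have hy1 : x.2 i ≤ 1 := hx.2 i
  have hDx := hD x.2 hx
  set t := x.1 + b ⬝ᵥ x.2
  have hshift : x.1 + (b + Pi.single i δ) ⬝ᵥ x.2 = t + δ * x.2 i := by
    rw [add_dotProduct, single_dotProduct, ← add_assoc]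
  simp only [Pi.smul_apply, Pi.sub_apply, smul_eq_mul, hshift]
  have h1 := abs_sub_difference_quotient_le hT0 hf hfT hkT hosc hε.le hδ0 hδ1 hy0 hy1 t
  have hD0 : 0 ≤ D := (abs_nonneg _).trans hDx
  calc |m x.2 * x.2 i * k t - δ⁻¹ * (m x.2 * f (t + δ * x.2 i) - m x.2 * f t)| =
        |m x.2| * |x.2 i * k t - δ⁻¹ * (f (t + δ * x.2 i) - f t)| := by
        rw [← abs_mul]; congr 1; ring
    _ ≤ D * (ε * (1 + (T + 1)) ^ (3 / 4 : ℝ) * ((1 + ∑ i, |b i|) * decay x.1)) := by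
        refine mul_le_mul hDx (h1.trans ?_) (abs_nonneg _) hD0
        gcongr
        exact decay_ridge_le b hx _
    _ = _ := by ring

/-- This is the weighted size of a bump of height 1/R on [-R, R]; it is O(R^(-1/4)) because the
exponent 3/4 of the weight is below 1. -/
theorem exists_rpow_div_le {ε : ℝ} (hε : 0 < ε) :
    ∃ R : ℝ, 1 ≤ R ∧ R⁻¹ * (1 + R) ^ (3 / 4 : ℝ) ≤ ε := by
  refine ⟨max 1 ((2 / ε) ^ 4), le_max_left _ _, ?_⟩
  set R := max 1 ((2 / ε) ^ 4)
  have hR1 : 1 ≤ R := le_max_left _ _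
  have hR0 : 0 < R := by linarith
  have h1 : (1 + R) ^ (3 / 4 : ℝ) ≤ 2 * R ^ (3 / 4 : ℝ) := by
    calc (1 + R) ^ (3 / 4 : ℝ) ≤ (2 * R) ^ (3 / 4 : ℝ) := by gcongr; linarith
      _ = 2 ^ (3 / 4 : ℝ) * R ^ (3 / 4 : ℝ) := Real.mul_rpow (by norm_num) hR0.le
      _ ≤ 2 ^ (1 : ℝ) * R ^ (3 / 4 : ℝ) := by gcongr <;> norm_num
      _ = _ := by rw [Real.rpow_one]
  have h2 : 2 / ε ≤ R ^ (1 / 4 : ℝ) := by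
    calc 2 / ε = ((2 / ε) ^ 4) ^ (1 / 4 : ℝ) := by
          rw [← Real.rpow_natCast, ← Real.rpow_mul (by positivity)]; norm_num
      _ ≤ _ := by gcongr; exact le_max_right _ _
  have h3 : R = R ^ (1 / 4 : ℝ) * R ^ (3 / 4 : ℝ) := by
    rw [← Real.rpow_add hR0]; norm_num
  have h4 : 2 ≤ ε * R ^ (1 / 4 : ℝ) := by rwa [div_le_iff₀' hε] at h2
  rw [inv_mul_le_iff₀ hR0]
  calc _ ≤ 2 * R ^ (3 / 4 : ℝ) := h1
    _ ≤ ε * R ^ (1 / 4 : ℝ) * R ^ (3 / 4 : ℝ) := by gcongr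
    _ = R * ε := by nth_rewrite 3 [h3]; ring

theorem deriv_smoothTransition_eq_zero {s : ℝ} (hs : 1 < |s|) :
    deriv Real.smoothTransition s = 0 := by
  rcases lt_abs.1 hs with h | h
  · have : Real.smoothTransition =ᶠ[𝓝 s] fun _ => 1 := by
      filter_upwards [lt_mem_nhds h] with x hx using Real.smoothTransition.one_of_one_le hx.le
    rw [this.deriv_eq, deriv_const]
  · have : Real.smoothTransition =ᶠ[𝓝 s] fun _ => 0 := by
      filter_upwards [gt_mem_nhds (by linarith : s < 0)] with x hx
        using Real.smoothTransition.zero_of_nonpos hx.le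
    rw [this.deriv_eq, deriv_const]

/-- Up to an error `η` with values at most `C / R` and support in `[-R, R]`, a continuous compactly
supported function is the derivative of a compactly supported function. -/
theorem exists_primitive {g : ℝ → ℝ} (hg : Continuous g) (hg' : HasCompactSupport g) :
    ∃ C T : ℝ, 0 ≤ T ∧ ∀ R : ℝ, 1 ≤ R → ∃ f k : ℝ → ℝ, (∀ s, HasDerivAt f (k s) s) ∧
      Continuous k ∧ (∀ s, T + R < |s| → f s = 0) ∧ (∀ s, T + R < |s| → k s = 0) ∧
      (∀ s, |g s - k s| ≤ C * R⁻¹) ∧ ∀ s, R < |s| → g s - k s = 0 := by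
  obtain ⟨T, hT0, hT⟩ := exists_forall_lt_abs_eq_zero hg'
  have hHc : Continuous (deriv Real.smoothTransition) :=
    (Real.smoothTransition.contDiff (n := 1)).continuous_deriv le_rfl
  obtain ⟨D, hD⟩ := (hasCompactSupport_of_forall_lt_abs
    fun s hs => deriv_smoothTransition_eq_zero hs).exists_bound_of_continuous hHc
  set c := ∫ u in (-T)..T, g u with hc
  have hG (s : ℝ) : HasDerivAt (fun s => ∫ u in (-T)..s, g u) (g s) s :=
    (hg.integral_hasStrictDerivAt (-T) s).hasDerivAt
  have hGl (s : ℝ) (hs : s ≤ -T) : ∫ u in (-T)..s, g u = 0 := by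
    rw [intervalIntegral.integral_symm, intervalIntegral.integral_congr (g := fun _ => 0)]
    · simp
    · intro u hu
      rw [uIcc_of_le hs] at hu
      exact hT u (le_abs.2 (Or.inr (by linarith [hu.2])))
  have hGr (s : ℝ) (hs : T ≤ s) : ∫ u in (-T)..s, g u = c := by
    rw [← intervalIntegral.integral_add_adjacent_intervals (b := T)
      (hg.intervalIntegrable _ _) (hg.intervalIntegrable _ _),
      intervalIntegral.integral_congr (a := T) (b := s) (g := fun _ => 0)]
    · simp [hc]
    · intro u hu
      rw [uIcc_of_le hs] at hu
      exact hT u (le_abs.2 (Or.inl hu.1))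
  -- The primitive of g equals c to the right of T. Subtracting c times a smooth step of width R
  -- makes it vanish there, at the cost of a derivative of size at most |c| D / R.
  refine ⟨|c| * D, T, hT0.le, fun R hR => ⟨fun s => (∫ u in (-T)..s, g u) -
    c * Real.smoothTransition (s / R), fun s => g s - c * (deriv Real.smoothTransition (s / R) / R),
    fun s => ?_, by fun_prop, fun s hs => ?_, fun s hs => ?_, fun s => ?_, fun s hs => ?_⟩⟩
  · refine (hG s).sub (HasDerivAt.const_mul c ?_)
    have h1 : HasDerivAt Real.smoothTransition (deriv Real.smoothTransition (s / R)) (s / R) :=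
      ((Real.smoothTransition.contDiff (n := 1)).differentiable one_ne_zero _).hasDerivAt
    have h2 := h1.comp s ((hasDerivAt_id s).div_const R)
    rwa [mul_one_div] at h2
  · have hR0 : 0 < R := by linarith
    beta_reduce
    rcases lt_abs.1 hs with h | h
    · rw [hGr s (by linarith), Real.smoothTransition.one_of_one_le
        ((one_le_div hR0).2 (by linarith)), mul_one, sub_self]
    · rw [hGl s (by linarith), Real.smoothTransition.zero_of_nonpos
        (div_nonpos_of_nonpos_of_nonneg (by linarith) hR0.le), mul_zero, sub_self]
  · have hR0 : 0 < R := by linarith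
    beta_reduce
    rw [hT s (by linarith), deriv_smoothTransition_eq_zero (by
      rw [abs_div, abs_of_pos hR0, one_lt_div hR0]; linarith)]
    simp
  · rw [sub_sub_cancel, abs_mul, abs_div, abs_of_pos (by linarith : 0 < R), mul_assoc,
      ← div_eq_mul_inv]
    have := hD (s / R)
    rw [Real.norm_eq_abs] at this
    gcongr
  · rw [sub_sub_cancel, deriv_smoothTransition_eq_zero (by
      rw [abs_div, abs_of_pos (by linarith : 0 < R), one_lt_div (by linarith)]; linarith)]
    simp

/-- Replace g by the derivative k from `exists_primitive`, to which
`IsRidgeMultiplier.mul_deriv_mem` applies; the error g - k is negligible for large R. -/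
theorem IsRidgeMultiplier.mul_coord {S : Submodule ℝ (ℝ × (Fin n → ℝ) → ℝ)}
    {m : (Fin n → ℝ) → ℝ} (hm : IsRidgeMultiplier S m) (i : Fin n) :
    IsRidgeMultiplier S (fun y => m y * y i) := by
  have hmD := hm.1
  obtain ⟨D, hD⟩ := hmD
  have hD' : ∀ y ∈ Icc (0 : Fin n → ℝ) 1, |m y * y i| ≤ D := fun y hy => by
    rw [abs_mul, abs_of_nonneg (hy.1 i)]
    exact (mul_le_of_le_one_right (abs_nonneg _) (hy.2 i)).trans (hD y hy)
  refine ⟨⟨D, hD'⟩, fun g hg hg' b => ?_⟩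
  obtain ⟨C, T, hT0, h⟩ := exists_primitive hg hg'
  refine mem_approx_of_limit (D * (C * (1 + ∑ i, |b i|))) fun ε hε => ?_
  obtain ⟨R, hR1, hR⟩ := exists_rpow_div_le hε
  obtain ⟨f, k, hf, hk, hfT, hkT, hgk, hgkR⟩ := h R hR1
  refine ⟨_, hm.mul_deriv_mem (by linarith) hf hk hfT hkT i b, fun x hx => ?_⟩
  have h1 := abs_le_mul_decay (h := fun s => g s - k s) hgk (by linarith) hgkR (x.1 + b ⬝ᵥ x.2)
  have hC : 0 ≤ C := by
    have := (abs_nonneg _).trans (hgk 0)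
    exact nonneg_of_mul_nonneg_left this (by positivity)
  have hD0 : 0 ≤ D := (abs_nonneg _).trans (hD' x.2 hx)
  rw [← mul_sub, abs_mul]
  calc _ ≤ D * (C * R⁻¹ * (1 + R) ^ (3 / 4 : ℝ) * ((1 + ∑ i, |b i|) * decay x.1)) := by
        refine mul_le_mul (hD' x.2 hx) (h1.trans ?_) (abs_nonneg _) hD0
        gcongr
        exact decay_ridge_le b hx _
    _ = D * (C * (R⁻¹ * (1 + R) ^ (3 / 4 : ℝ)) * ((1 + ∑ i, |b i|) * decay x.1)) := by ring
    _ ≤ D * (C * ε * ((1 + ∑ i, |b i|) * decay x.1)) := by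
        have := decay_pos x.1
        gcongr
    _ = _ := by ring

theorem isRidgeMultiplier_one {φ : ℝ → ℝ} (hφ : IsReLULike φ) :
    IsRidgeMultiplier (ridgeSpan φ n) 1 :=
  ⟨⟨1, fun y _ => by simp⟩, fun g hg hg' b => by simpa using ridge_mem_approx hφ hg hg' b⟩

/-! ### Polynomials and Stone–Weierstrass -/

/-- The span of the products of a ridge multiplier in the last `n` coordinates and a continuous
compactly supported function in the first coordinate. -/
def productSpan (S : Submodule ℝ (ℝ × (Fin n → ℝ) → ℝ)) :
    Submodule ℝ (ℝ × (Fin n → ℝ) → ℝ) :=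
  Submodule.span ℝ {F | ∃ (m : (Fin n → ℝ) → ℝ) (g : ℝ → ℝ), IsRidgeMultiplier S m ∧
    Continuous g ∧ HasCompactSupport g ∧ F = fun x => m x.2 * g x.1}

theorem productSpan_le_approx (S : Submodule ℝ (ℝ × (Fin n → ℝ) → ℝ)) :
    productSpan S ≤ approx S := by
  refine Submodule.span_le.2 ?_
  rintro _ ⟨m, g, hm, hg, hg', rfl⟩
  simpa using hm.2 g hg hg' 0

theorem mul_mem_productSpan_of_generators {S : Submodule ℝ (ℝ × (Fin n → ℝ) → ℝ)}
    {P : ℝ × (Fin n → ℝ) → ℝ}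
    (hP : ∀ (m : (Fin n → ℝ) → ℝ) (g : ℝ → ℝ), IsRidgeMultiplier S m → Continuous g →
      HasCompactSupport g → (P * fun x => m x.2 * g x.1) ∈ productSpan S)
    {F : ℝ × (Fin n → ℝ) → ℝ} (hF : F ∈ productSpan S) : P * F ∈ productSpan S := by
  have : productSpan S ≤ (productSpan S).comap (LinearMap.mulLeft ℝ P) := by
    refine Submodule.span_le.2 ?_
    rintro _ ⟨m, g, hm, hg, hg', rfl⟩
    exact hP m g hm hg hg'
  exact this hF

/-- The algebra of polynomial functions on `ℝ × ℝⁿ`. -/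
def polynomials (n : ℕ) : Subalgebra ℝ C(ℝ × (Fin n → ℝ), ℝ) :=
  Algebra.adjoin ℝ (insert ⟨Prod.fst, continuous_fst⟩
    (range fun i : Fin n => ⟨fun x => x.2 i, by fun_prop⟩))

theorem polynomials_separatesPoints (n : ℕ) : (polynomials n).SeparatesPoints := by
  intro x y hxy
  by_cases h : x.1 = y.1
  · obtain ⟨i, hi⟩ : ∃ i, x.2 i ≠ y.2 i := by
      by_contra! h'
      exact hxy (Prod.ext h (funext h'))
    exact ⟨_, ⟨_, Algebra.subset_adjoin (mem_insert_of_mem _ ⟨i, rfl⟩), rfl⟩, hi⟩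
  · exact ⟨_, ⟨_, Algebra.subset_adjoin (mem_insert _ _), rfl⟩, h⟩

theorem mul_mem_productSpan {S : Submodule ℝ (ℝ × (Fin n → ℝ) → ℝ)}
    {P : C(ℝ × (Fin n → ℝ), ℝ)} (hP : P ∈ polynomials n) :
    ∀ F ∈ productSpan S, ⇑P * F ∈ productSpan S := by
  induction hP using Algebra.adjoin_induction with
  | mem P hP =>
    intro F hF
    refine mul_mem_productSpan_of_generators (fun m g hm hg hg' => Submodule.subset_span ?_) hF
    rcases hP with rfl | ⟨i, rfl⟩
    -- The first coordinate is absorbed into g, the others into the multiplier.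
    · exact ⟨m, fun t => t * g t, hm, by fun_prop, hg'.mul_left, by
        ext x; simp only [Pi.mul_apply, ContinuousMap.coe_mk]; ring⟩
    · exact ⟨_, g, hm.mul_coord i, hg, hg', by
        ext x; simp only [Pi.mul_apply, ContinuousMap.coe_mk]; ring⟩
  | algebraMap r =>
    intro F hF
    have : ⇑(algebraMap ℝ C(ℝ × (Fin n → ℝ), ℝ) r) * F = r • F := by
      ext x; simp
    rw [this]
    exact Submodule.smul_mem _ r hF
  | add P Q _ _ hP hQ =>
    intro F hF
    rw [ContinuousMap.coe_add, add_mul]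
    exact Submodule.add_mem _ (hP F hF) (hQ F hF)
  | mul P Q _ _ hP hQ =>
    intro F hF
    rw [ContinuousMap.coe_mul, mul_assoc]
    exact hP _ (hQ F hF)

/-- A trapezoidal cutoff function on the real line. -/
theorem exists_cutoff (T : ℝ) : ∃ χ : ℝ → ℝ, Continuous χ ∧ (∀ s, |s| ≤ T → χ s = 1) ∧
    (∀ s, T + 1 < |s| → χ s = 0) ∧ ∀ s, |χ s| ≤ 1 := by
  refine ⟨fun s => max 0 (min 1 (T + 1 - |s|)), by fun_prop, fun s hs => ?_, fun s hs => ?_,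
    fun s => ?_⟩
  · beta_reduce
    rw [min_eq_left (by linarith), max_eq_right zero_le_one]
  · exact max_eq_left ((min_le_right _ _).trans (by linarith))
  · rw [abs_of_nonneg (le_max_left _ _)]
    exact max_le zero_le_one (min_le_left _ _)

theorem mem_approx_of_hasCompactSupport {φ : ℝ → ℝ} (hφ : IsReLULike φ)
    {F : ℝ × (Fin n → ℝ) → ℝ} (hF : Continuous F) (hF' : HasCompactSupport F) :
    F ∈ approx (ridgeSpan φ n) := by
  obtain ⟨T, hT⟩ := hF'.isCompact.isBounded.exists_norm_le
  have hT' : ∀ x, max T 0 < |x.1| → F x = 0 := fun x hx =>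
    image_eq_zero_of_notMem_tsupport fun h => by
      have := (norm_fst_le x).trans (hT x h)
      rw [Real.norm_eq_abs] at this
      exact absurd hx (not_lt.2 (this.trans (le_max_left _ _)))
  set R := max T 0
  have hR : 0 ≤ R := le_max_right _ _
  obtain ⟨χ, hχ, hχ1, hχ0, hχb⟩ := exists_cutoff R
  refine mem_approx_of_limit ((1 + (R + 1)) ^ (3 / 4 : ℝ)) fun ε hε => ?_
  -- F = F χ, so it suffices that P be close to F where χ may be nonzero, which is why the box
  -- extends to R + 1.
  obtain ⟨P, hP, hPF⟩ :=
    ContinuousMap.exists_mem_subalgebra_near_continuous_of_isCompact_of_separatesPoints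
      (polynomials_separatesPoints n) ⟨F, hF⟩
      (K := Icc (-(R + 1)) (R + 1) ×ˢ Icc (0 : Fin n → ℝ) 1) (isCompact_Icc.prod isCompact_Icc) hε
  refine ⟨⇑P * fun x => (1 : (Fin n → ℝ) → ℝ) x.2 * χ x.1, productSpan_le_approx _ <|
    mul_mem_productSpan hP _ <| Submodule.subset_span ⟨1, χ, isRidgeMultiplier_one hφ, hχ,
      hasCompactSupport_of_forall_lt_abs hχ0, rfl⟩, fun x hx => ?_⟩
  have hFx : F x = F x * χ x.1 := by
    rcases le_or_gt |x.1| R with h | h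
    · rw [hχ1 _ h, mul_one]
    · rw [hT' x h, zero_mul]
  simp only [Pi.mul_apply, Pi.one_apply, one_mul]
  rw [hFx, ← sub_mul, abs_mul]
  have h0 := decay_pos x.1
  rcases le_or_gt |x.1| (R + 1) with h | h
  · have h1 := hPF x ⟨abs_le.1 h, hx⟩
    rw [Real.norm_eq_abs, abs_sub_comm] at h1
    calc |F x - P x| * |χ x.1| ≤ ε * 1 := by
          gcongr
          · exact h1.le
          · exact hχb _
      _ ≤ ε * ((1 + (R + 1)) ^ (3 / 4 : ℝ) * decay x.1) := by
          gcongr; exact one_le_mul_decay h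
      _ = _ := by ring
  · rw [hχ0 _ h, abs_zero, mul_zero]
    positivity

/-! ### Transfer to Lᵖ of the strip -/

/-- The splitting of the first coordinate. -/
def splitFirst (x : EuclideanSpace ℝ (Fin (n + 1))) : ℝ × (Fin n → ℝ) := (x 0, fun i => x i.succ)

/-- The inverse of `splitFirst`. -/
def joinFirst (x : ℝ × (Fin n → ℝ)) : EuclideanSpace ℝ (Fin (n + 1)) :=
  WithLp.toLp 2 (Fin.cons x.1 x.2)

theorem joinFirst_splitFirst (x : EuclideanSpace ℝ (Fin (n + 1))) : joinFirst (splitFirst x) = x := by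
  ext i
  refine Fin.cases ?_ (fun i => ?_) i <;> simp [joinFirst, splitFirst]

theorem splitFirst_joinFirst (x : ℝ × (Fin n → ℝ)) : splitFirst (joinFirst x) = x := by
  simp [joinFirst, splitFirst]

theorem continuous_splitFirst : Continuous (splitFirst (n := n)) := by
  unfold splitFirst; fun_prop

theorem continuous_joinFirst : Continuous (joinFirst (n := n)) := by
  refine (PiLp.continuous_toLp 2 _).comp (continuous_pi fun i => ?_)
  refine Fin.cases ?_ (fun i => ?_) i
  · simpa using continuous_fst
  · simpa using! (continuous_apply i).comp continuous_snd

theorem inner_joinFirst (a : ℝ) (b : Fin n → ℝ) (x : EuclideanSpace ℝ (Fin (n + 1))) :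
    inner ℝ (joinFirst (a, b)) x = a * (splitFirst x).1 + b ⬝ᵥ (splitFirst x).2 := by
  simp [PiLp.inner_apply, Fin.sum_univ_succ, joinFirst, splitFirst, dotProduct, mul_comm]

theorem comp_splitFirst_mem_networks {φ : ℝ → ℝ} {N : ℝ × (Fin n → ℝ) → ℝ}
    (hN : N ∈ ridgeSpan φ n) : N ∘ splitFirst ∈ networks (n + 1) φ := by
  obtain ⟨k, t, g, rfl⟩ := Submodule.mem_span_set'.1 hN
  choose a b c h using fun i => (g i).2
  refine ⟨k, fun i => joinFirst (a i, b i), c, t, ?_⟩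
  ext x
  simp [h, inner_joinFirst]

/-- For p ≥ 2 the p-th power has decay exponent 3p/4 ≥ 3/2 > 1. -/
theorem memLp_decay {p : ENNReal} (hp : 2 ≤ p) (hp_top : p ≠ ⊤) : MemLp decay p volume := by
  have hp0 : p ≠ 0 := (lt_of_lt_of_le (by norm_num) hp).ne'
  have hp2 : 2 ≤ p.toReal := by
    simpa using (ENNReal.toReal_le_toReal (by norm_num) hp_top).2 hp
  have hm : Measurable decay := by unfold decay; fun_prop
  rw [← integrable_norm_rpow_iff hm.aestronglyMeasurable hp0 hp_top]
  have h : (fun t => ‖decay t‖ ^ p.toReal) = fun t : ℝ => (1 + ‖t‖) ^ (-(3 / 4 * p.toReal)) := by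
    ext t
    rw [Real.norm_of_nonneg (decay_pos t).le, decay, ← Real.rpow_mul (by positivity), neg_mul,
      Real.norm_eq_abs]
  rw [h]
  exact integrable_one_add_norm (by simp; linarith)

theorem measurableSet_strip (n : ℕ) : MeasurableSet (strip n) := by
  have : strip n = ⋂ i : Fin n, (fun x : EuclideanSpace ℝ (Fin (n + 1)) => x i.succ) ⁻¹' Icc 0 1 := by
    ext x; simp [strip]
  rw [this]
  exact MeasurableSet.iInter fun i => measurableSet_Icc.preimage (by fun_prop)

/-- The unit cube has volume one, so that the projection of the strip to its first coordinate
preserves Lebesgue measure. -/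
theorem measurePreserving_first (n : ℕ) :
    MeasurePreserving (fun x : EuclideanSpace ℝ (Fin (n + 1)) => x 0)
      (volume.restrict (strip n)) volume := by
  have hm : Measurable fun x : EuclideanSpace ℝ (Fin (n + 1)) => x 0 := by fun_prop
  refine ⟨hm, ?_⟩
  ext s hs
  rw [Measure.map_apply hm hs, Measure.restrict_apply (hm hs)]
  have h : (fun x : EuclideanSpace ℝ (Fin (n + 1)) => x 0) ⁻¹' s ∩ strip n =
      WithLp.ofLp ⁻¹' (univ.pi (Fin.cons s fun _ : Fin n => Icc (0 : ℝ) 1)) := by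
    ext x
    simp [strip, Fin.forall_fin_succ, Set.mem_pi]
  have hms : MeasurableSet (univ.pi (Fin.cons s fun _ : Fin n => Icc (0 : ℝ) 1) :
      Set (Fin (n + 1) → ℝ)) := by
    refine MeasurableSet.univ_pi fun i => ?_
    refine Fin.cases ?_ (fun i => ?_) i
    · simpa using hs
    · simp
  rw [h, (PiLp.volume_preserving_ofLp (Fin (n + 1))).measure_preimage hms.nullMeasurableSet,
    volume_pi_pi, Fin.prod_univ_succ]
  simp

theorem measurable_of_mem_ridgeSpan {φ : ℝ → ℝ} (hφ : Measurable φ) {N : ℝ × (Fin n → ℝ) → ℝ}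
    (hN : N ∈ ridgeSpan φ n) : Measurable N := by
  induction hN using Submodule.span_induction with
  | mem N hN =>
    obtain ⟨a, b, c, rfl⟩ := hN
    unfold dotProduct
    fun_prop
  | zero => exact measurable_zero
  | add N P _ _ hN hP => exact hN.add hP
  | smul c N _ hN => exact hN.const_smul c

/-- Half of ε goes to approximating f by a function g in C_c, half to approximating g by a network
within δ times the weight. -/
theorem isUniversalApproximator_of_isReLULike {φ : ℝ → ℝ} (hφ : IsReLULike φ)
    (hφm : Measurable φ) (n : ℕ) (p : ENNReal) [Fact (1 ≤ p)] (hp : 2 ≤ p) (hp_top : p ≠ ⊤) :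
    IsUniversalApproximator (networks (n + 1) φ) p (strip n) := by
  refine eq_univ_of_forall fun f => EMetric.mem_closure_iff.2 fun ε hε => ?_
  let μ := (volume : Measure (EuclideanSpace ℝ (Fin (n + 1)))).restrict (strip n)
  have hε2 : ε / 2 ≠ 0 := (ENNReal.half_pos hε.ne').ne'
  obtain ⟨g, hgs, hfg, hgc, hgp⟩ :=
    (Lp.memLp f).exists_hasCompactSupport_eLpNorm_sub_le hp_top hε2
  let W : EuclideanSpace ℝ (Fin (n + 1)) → ℝ := fun x => decay (x 0)
  have hWp : MemLp W p μ := (memLp_decay hp hp_top).comp_measurePreserving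
    (measurePreserving_first n)
  obtain ⟨δ, hδ0, hδ⟩ : ∃ δ : ℝ, 0 < δ ∧ ENNReal.ofReal δ * eLpNorm W p μ < ε / 2 := by
    obtain ⟨δ, hδ0, hδ⟩ := ENNReal.exists_nnreal_pos_mul_lt hWp.eLpNorm_ne_top hε2
    exact ⟨δ, by exact_mod_cast hδ0, by simpa using hδ⟩
  obtain ⟨N, hN, hgN⟩ := mem_approx_of_hasCompactSupport hφ (hgc.comp continuous_joinFirst)
    (hgs.comp_homeomorph ⟨⟨joinFirst, splitFirst, splitFirst_joinFirst, joinFirst_splitFirst⟩,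
      continuous_joinFirst, continuous_splitFirst⟩) δ hδ0
  have hbound : ∀ᵐ x ∂μ, ‖(g - N ∘ splitFirst) x‖ ≤ δ * ‖W x‖ := by
    refine (ae_restrict_mem (measurableSet_strip n)).mono fun x hx => ?_
    have := hgN (splitFirst x) ⟨fun i => (hx i).1, fun i => (hx i).2⟩
    rw [Function.comp_apply, joinFirst_splitFirst] at this
    rwa [Real.norm_of_nonneg (decay_pos _).le]
  have hNm : AEStronglyMeasurable (N ∘ splitFirst) μ :=
    ((measurable_of_mem_ridgeSpan hφm hN).comp
      continuous_splitFirst.measurable).aestronglyMeasurable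
  -- The single ridge functions need not lie in Lᵖ; the network does, because g does and g - N is
  -- dominated by the weight.
  have hNp : MemLp (N ∘ splitFirst) p μ := by
    have := hgp.sub (MemLp.of_le_mul hWp (hgc.aestronglyMeasurable.sub hNm) hbound)
    rwa [sub_sub_cancel] at this
  refine ⟨hNp.toLp, ⟨_, comp_splitFirst_mem_networks hN, hNp.coeFn_toLp⟩, ?_⟩
  have hdist : edist f hNp.toLp = eLpNorm (⇑f - N ∘ splitFirst) p μ := by
    rw [Lp.edist_def]
    exact eLpNorm_congr_ae ((ae_eq_refl _).sub hNp.coeFn_toLp)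
  rw [hdist, ← sub_add_sub_cancel _ g]
  refine (eLpNorm_add_le ((Lp.aestronglyMeasurable f).sub hgc.aestronglyMeasurable)
    (hgc.aestronglyMeasurable.sub hNm) Fact.out).trans_lt ?_
  calc _ < ε / 2 + ε / 2 := ENNReal.add_lt_add_of_le_of_lt
        ((Lp.memLp f).sub hgp).eLpNorm_ne_top hfg
        ((eLpNorm_le_mul_eLpNorm_of_ae_le_mul hbound p).trans_lt hδ)
    _ = ε := ENNReal.add_halves ε

end

end ShallowNet

theorem theorem3p8 (n : ℕ) (p : ENNReal) [Fact (1 ≤ p)] (hp : 2 ≤ p) (hp_top : p ≠ ⊤) :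
    ShallowNet.IsUniversalApproximator
        (ShallowNet.networks (n + 1) ShallowNet.reLU) p (ShallowNet.strip n) ∧
    (∀ α : ℝ, ShallowNet.IsUniversalApproximator
        (ShallowNet.networks (n + 1) (ShallowNet.elu α)) p (ShallowNet.strip n)) ∧
    ShallowNet.IsUniversalApproximator
        (ShallowNet.networks (n + 1) ShallowNet.softplus) p (ShallowNet.strip n) ∧
    (∀ α : ℝ, α ≠ 1 → ShallowNet.IsUniversalApproximator
        (ShallowNet.networks (n + 1) (ShallowNet.leakyReLU α)) p (ShallowNet.strip n)) := by
  refine ⟨?_, fun α => ?_, ?_, fun α hα => ?_⟩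
  · exact ShallowNet.isUniversalApproximator_of_isReLULike ShallowNet.isReLULike_reLU
      ShallowNet.measurable_reLU n p hp hp_top
  · exact ShallowNet.isUniversalApproximator_of_isReLULike (ShallowNet.isReLULike_elu α)
      (ShallowNet.measurable_elu α) n p hp hp_top
  · exact ShallowNet.isUniversalApproximator_of_isReLULike ShallowNet.isReLULike_softplus
      ShallowNet.measurable_softplus n p hp hp_top
  · exact ShallowNet.isUniversalApproximator_of_isReLULike (ShallowNet.isReLULike_leakyReLU hα)
      (ShallowNet.measurable_leakyReLU α) n p hp hp_top
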